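/- All topological spaces are Hausdorff. A topological inverse semigroup is an inverse semigroup with a topology in which multiplication and inversion $x\mapsto x^{-1}$ are continuous. A semigroup $S$ with zero is $0$-simple if $S\cdot S\neq\{0\}$ and $\{0\}$ and $S$ are its only two-sided ideals. A homomorphism is non-trivial if it is not constant. Let $\mathscr{CC\!T\!B}_{\mathrm{fin}}\mathscr{G}$ [resp. $\mathscr{C\!T\!B}_{\mathrm{fin}}\mathscr{G}$] be the category whose objects are the pairs $(G,I)$ with $G$ a countably compact [resp. compact] topological group and $I$ a non-empty finite set; a morphism $(G,I)\to(H,J)$ is a triple $(h,u,\varphi)$ consisting of a continuous group homomorphism $h\colon G\to H$, a map $u\colon I\to H$ and an injective map $\varphi\colon I\to J$; the composition of $(h,u,\varphi)\colon(G,I)\to(H,J)$ followed by $(h',u',\varphi')\colon(H,J)\to(K,L)$ is $(h'\circ h,\,w,\,\varphi'\circ\varphi)$ with $w(\alpha)=u'(\varphi(\alpha))\cdot h'(u(\alpha))$, and the identity of $(G,I)$ is $(\mathrm{id}_G,1,\mathrm{id}_I)$, where $1$ is the constant map with value $1_G$. Let $\mathscr{B}^*(\mathscr{CC\!T\!G})$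 [resp. $\mathscr{B}^*(\mathscr{C\!T\!G})$] be the category whose objects are all $0$-simple countably compact [resp. compact] topological inverse semigroups and whose morphisms are the non-trivial continuous homomorphisms. For a pair $(G,I)$ let $\mathbf{B}(G,I)=(I\times G\times I)\cup\{0\}$ be the Brandt semigroup, with $(\alpha,a,\beta)(\beta,b,\delta)=(\alpha,ab,\delta)$ and all other products equal to $0$, topologized so that $0$ is isolated and, for all $\alpha,\beta\in I$, the set $\{\alpha\}\times G\times\{\beta\}$ is open and carries the topology of $G$. For a morphism $(h,u,\varphi)$ let $\mathbf{B}(h,u,\varphi)$ map $0$ to $0$ and $(\alpha,g,\beta)$ to $(\varphi(\alpha),\,u(\alpha)\,h(g)\,u(\beta)^{-1},\,\varphi(\beta))$. Then $\mathbf{B}$ is a functor from $\mathscr{CC\!T\!B}_{\mathrm{fin}}\mathscr{G}$ into $\mathscr{B}^*(\mathscr{CC\!T\!G})$ [resp. from $\mathscr{C\!T\!B}_{\mathrm{fin}}\mathscr{G}$ into $\mathscr{B}^*(\mathscr{C\!T\!G})$], it is full (every morphism $\mathbf{B}(X)\to\mathbf{B}(Y)$ is $\mathbf{B}(f)$ for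 some morphism $f\colon X\to Y$) and it is representative (every object of the target category is isomorphic, in that category, to $\mathbf{B}(X)$ for some pair $X$). -/

import Mathlib

open CategoryTheory Filter Topology

universe u

/-! ## Inverse semigroups and `0`-simple semigroups -/

/-- `S` is an inverse semigroup and `a⁻¹` is the inverse of `a`: it is the unique element `b` with
`a * b * a = a` and `b * a * b = b`. -/
class IsInverseSemigroup (S : Type*) [Semigroup S] [Inv S] : Prop where
  mul_inv_mul : ∀ a : S, a * a⁻¹ * a = a
  inv_mul_inv : ∀ a : S, a⁻¹ * a * a⁻¹ = a⁻¹
  eq_inv : ∀ a b : S, a * b * a = a → b * a * b = b → b = a⁻¹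

/-- A semigroup with zero is `0`-simple if its multiplication is not identically zero and `{0}` and
the whole semigroup are its only (nonempty, two-sided) ideals. -/
def IsZeroSimple (S : Type*) [SemigroupWithZero S] : Prop :=
  (∃ a b : S, a * b ≠ 0) ∧
    ∀ J : Set S, J.Nonempty → (∀ a ∈ J, ∀ s : S, s * a ∈ J ∧ a * s ∈ J) →
      J = {0} ∨ J = Set.univ

/-! ## Homomorphisms of countably compact `0`-simple topological inverse semigroups

The facts of this section are only needed to see that the composition of two non-trivial
(i.e. non-constant) continuous homomorphisms is again non-trivial. -/

namespace IsInverseSemigroup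

variable {S : Type*} [Semigroup S] [Inv S] [IsInverseSemigroup S]

theorem mul_inv_mul_assoc (a b : S) : a * (a⁻¹ * (a * b)) = a * b := by
  rw [← mul_assoc, ← mul_assoc, mul_inv_mul]

theorem inv_inv' (a : S) : a⁻¹⁻¹ = a :=
  (eq_inv a⁻¹ a (inv_mul_inv a) (mul_inv_mul a)).symm

theorem inv_of_idem {e : S} (he : e * e = e) : e⁻¹ = e :=
  (eq_inv e e (by rw [he, he]) (by rw [he, he])).symm

theorem idem_mul {e f : S} (he : e * e = e) (hf : f * f = f) : (e * f) * (e * f) = e * f := by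
  have h1 := mul_inv_mul (e * f)
  have h2 := inv_mul_inv (e * f)
  set z := (e * f)⁻¹ with hz
  have he' : ∀ x, e * (e * x) = e * x := fun x => by rw [← mul_assoc, he]
  have hf' : ∀ x, f * (f * x) = f * x := fun x => by rw [← mul_assoc, hf]
  simp only [mul_assoc] at h1 h2
  have h2' : ∀ x, z * (e * (f * (z * x))) = z * x := fun x => by
    conv_rhs => rw [← h2]
    simp only [mul_assoc]
  have h3 : f * z * e = z := by
    apply eq_inv
    · simp only [mul_assoc, he', hf', h1]
    · simp only [mul_assoc, he', hf', h2']
  have h4 : z * z = z := by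
    conv_lhs => rw [← h3]
    conv_rhs => rw [← h3]
    simp only [mul_assoc, h2']
  have h5 : e * f = z := by
    rw [← inv_inv' (e * f), ← hz, inv_of_idem h4]
  rw [h5, h4]

theorem idem_comm {e f : S} (he : e * e = e) (hf : f * f = f) : e * f = f * e := by
  have h1 := idem_mul he hf
  have h2 := idem_mul hf he
  have he' : ∀ x, e * (e * x) = e * x := fun x => by rw [← mul_assoc, he]
  have hf' : ∀ x, f * (f * x) = f * x := fun x => by rw [← mul_assoc, hf]
  have h3 : f * e = (e * f)⁻¹ := by
    apply eq_inv
    · simpa only [mul_assoc, he', hf'] using h1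
    · simpa only [mul_assoc, he', hf'] using h2
  rw [h3, inv_of_idem h1]

theorem idem_mul_inv (a : S) : (a * a⁻¹) * (a * a⁻¹) = a * a⁻¹ := by
  rw [← mul_assoc, mul_inv_mul]

theorem idem_inv_mul (a : S) : (a⁻¹ * a) * (a⁻¹ * a) = a⁻¹ * a := by
  rw [← mul_assoc, inv_mul_inv]

theorem mul_inv_rev' (a b : S) : (a * b)⁻¹ = b⁻¹ * a⁻¹ := by
  have h := idem_comm (idem_mul_inv b) (idem_inv_mul a)
  symm
  apply eq_inv
  · calc a * b * (b⁻¹ * a⁻¹) * (a * b) = a * ((b * b⁻¹) * (a⁻¹ * a)) * b := by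
          simp only [mul_assoc]
      _ = (a * a⁻¹ * a) * (b * b⁻¹ * b) := by rw [h]; simp only [mul_assoc]
      _ = a * b := by rw [mul_inv_mul, mul_inv_mul]
  · calc b⁻¹ * a⁻¹ * (a * b) * (b⁻¹ * a⁻¹) = b⁻¹ * ((a⁻¹ * a) * (b * b⁻¹)) * a⁻¹ := by
          simp only [mul_assoc]
      _ = (b⁻¹ * b * b⁻¹) * (a⁻¹ * a * a⁻¹) := by rw [← h]; simp only [mul_assoc]
      _ = b⁻¹ * a⁻¹ := by rw [inv_mul_inv, inv_mul_inv]

variable [TopologicalSpace S] [ContinuousMul S] [ContinuousInv S] [T2Space S]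
  [CountablyCompactSpace S]

/-- The idempotents `a⁻ⁿ aⁿ`, `n ≥ 1`. -/
def powIdem (a : S) : ℕ → S
  | 0 => a⁻¹ * a
  | n + 1 => a⁻¹ * powIdem a n * a

/-- The powers `aⁿ`, `n ≥ 1`. -/
def powSeq (a : S) : ℕ → S
  | 0 => a
  | n + 1 => powSeq a n * a

theorem stable (a : S) (h : (a⁻¹ * a) * (a * a⁻¹) = a⁻¹ * a) : a⁻¹ * a = a * a⁻¹ := by
  set e := a * a⁻¹ with he
  have hea : e * a = a := mul_inv_mul a
  have hae' : a⁻¹ * e = a⁻¹ := by rw [he, ← mul_assoc, inv_mul_inv]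
  have hae : a * e = a := by
    calc a * e = a * ((a⁻¹ * a) * e) := by
          rw [← mul_assoc a (a⁻¹ * a) e, ← mul_assoc a a⁻¹ a, mul_inv_mul]
      _ = a := by rw [h, ← mul_assoc, mul_inv_mul]
  have hea' : e * a⁻¹ = a⁻¹ := by
    have := congrArg (·⁻¹) hae
    simpa only [mul_inv_rev', inv_of_idem (idem_mul_inv a), he] using this
  have hEe : ∀ n, e * powIdem a n = powIdem a n := fun n => by
    cases n <;> simp only [powIdem, ← mul_assoc, hea']
  have hE : ∀ n, (powSeq a n)⁻¹ * powSeq a n = powIdem a n := fun n => by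
    induction n with
    | zero => rfl
    | succ n ih => simp only [powSeq, powIdem, mul_inv_rev', ← ih, mul_assoc]
  have hp : ∀ n, powSeq a n * e = powSeq a n := fun n => by
    cases n <;> simp only [powSeq, mul_assoc, hae]
  have hpp : ∀ n, powSeq a n * (powSeq a n)⁻¹ = e := fun n => by
    induction n with
    | zero => rfl
    | succ n ih =>
      calc powSeq a n * a * (powSeq a n * a)⁻¹ = powSeq a n * e * (powSeq a n)⁻¹ := by
            rw [mul_inv_rev', he]; simp only [mul_assoc]
        _ = e := by rw [hp, ih]
  have hidem : ∀ n, powIdem a n * powIdem a n = powIdem a n := fun n => by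
    rw [← hE]; exact idem_inv_mul _
  have hdec1 : ∀ n, powIdem a (n + 1) * powIdem a n = powIdem a (n + 1) := fun n => by
    induction n with
    | zero =>
      calc a⁻¹ * (a⁻¹ * a) * a * (a⁻¹ * a) = a⁻¹ * (a⁻¹ * a) * (a * a⁻¹ * a) := by
            simp only [mul_assoc]
        _ = _ := by rw [mul_inv_mul]; rfl
    | succ n ih =>
      calc a⁻¹ * powIdem a (n + 1) * a * (a⁻¹ * powIdem a n * a)
          = a⁻¹ * (powIdem a (n + 1) * (e * powIdem a n)) * a := by
            rw [he]; simp only [mul_assoc]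
        _ = _ := by rw [hEe, ih]; rfl
  have hdec : ∀ k m, m ≤ k → powIdem a k * powIdem a m = powIdem a k := fun k m hmk => by
    induction k, hmk using Nat.le_induction with
    | base => exact hidem m
    | succ k _ ih => rw [← hdec1 k, mul_assoc, ih]
  obtain ⟨y, -, hy⟩ := IsCountablyCompact.seq_clusterPt
    (CountablyCompactSpace.isCountablyCompact_univ (E := S)) (powSeq a) (by simp)
  obtain ⟨U, hU, hpy⟩ := mapClusterPt_iff_ultrafilter.1 hy
  have hpy' : Tendsto (fun n => (powSeq a n)⁻¹) U (𝓝 y⁻¹) := hpy.inv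
  have hyy : y * y⁻¹ = e := by
    refine tendsto_nhds_unique (hpy.mul hpy') ?_
    simp only [hpp]
    exact tendsto_const_nhds
  set q := y⁻¹ * y with hq
  have hEq : Tendsto (powIdem a) U (𝓝 q) := by
    have := hpy'.mul hpy
    simpa only [hE] using this
  have hqE : ∀ m, q * powIdem a m = q := fun m => by
    refine tendsto_nhds_unique (hEq.mul_const (powIdem a m)) (hEq.congr' ?_)
    filter_upwards [hU (eventually_ge_atTop m)] with k hk using (hdec k m hk).symm
  have hEqc : ∀ m, powIdem a m * q = q := fun m => by
    rw [idem_comm (hidem m) (idem_inv_mul y), hqE]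
  have haE : ∀ n, 1 ≤ n → a * powIdem a n * a⁻¹ = powIdem a (n - 1) := fun n hn => by
    obtain ⟨k, rfl⟩ := Nat.exists_eq_add_of_le' hn
    have hEe' : powIdem a k * e = powIdem a k := by
      rw [idem_comm (hidem k) (idem_mul_inv a), hEe]
    calc a * (a⁻¹ * powIdem a k * a) * a⁻¹ = e * powIdem a k * e := by
          rw [he]; simp only [mul_assoc]
      _ = powIdem a k := by rw [hEe, hEe']
  have hEq' : Tendsto (fun n => powIdem a (n - 1)) U (𝓝 (a * q * a⁻¹)) := by
    refine ((hEq.const_mul a).mul_const a⁻¹).congr' ?_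
    filter_upwards [hU (eventually_ge_atTop 1)] with k hk using haE k hk
  have hq'E : ∀ m, a * q * a⁻¹ * powIdem a m = a * q * a⁻¹ := fun m => by
    refine tendsto_nhds_unique (hEq'.mul_const (powIdem a m)) (hEq'.congr' ?_)
    filter_upwards [hU (eventually_ge_atTop (m + 1))] with k hk
      using (hdec (k - 1) m (by omega)).symm
  have hq'q : a * q * a⁻¹ * q = a * q * a⁻¹ := by
    refine tendsto_nhds_unique (hEq.const_mul (a * q * a⁻¹)) ?_
    simp only [hq'E]
    exact tendsto_const_nhds
  have hq'q2 : a * q * a⁻¹ * q = q := by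
    refine tendsto_nhds_unique (hEq'.mul_const q) ?_
    simp only [hEqc]
    exact tendsto_const_nhds
  have haq : a * q * a⁻¹ = q := hq'q.symm.trans hq'q2
  have hpq : ∀ n, powSeq a n * q * (powSeq a n)⁻¹ = q := fun n => by
    induction n with
    | zero => exact haq
    | succ n ih =>
      calc powSeq a n * a * q * (powSeq a n * a)⁻¹
          = powSeq a n * (a * q * a⁻¹) * (powSeq a n)⁻¹ := by
            rw [mul_inv_rev']; simp only [mul_assoc]
        _ = q := by rw [haq, ih]
  have hyq : y * q * y⁻¹ = q := by
    refine tendsto_nhds_unique ((hpy.mul_const q).mul hpy') ?_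
    simp only [hpq]
    exact tendsto_const_nhds
  have hqe : q = e := by
    rw [← hyq, hq, ← mul_assoc, mul_inv_mul, hyy]
  have := hqE 0
  rw [hqe, hEe] at this
  exact this

end IsInverseSemigroup

section NonTrivial

open IsInverseSemigroup

variable {T : Type*} [SemigroupWithZero T] [Inv T] [IsInverseSemigroup T] [TopologicalSpace T]
  [ContinuousMul T] [ContinuousInv T] [T2Space T] [CountablyCompactSpace T]

theorem IsZeroSimple.idem_eq (hT : IsZeroSimple T) {e f : T} (he : e * e = e) (hf : f * f = f)
    (hf0 : f ≠ 0) (hfe : f * e = f) : f = e := by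
  have hef : e * f = f := by rw [idem_comm he hf, hfe]
  have hmem : ∃ s t : T, s * f * t = e := by
    have h := hT.2 {x | ∃ s t : T, s * f * t = x} ⟨_, f, f, rfl⟩ (by
      rintro _ ⟨s, t, rfl⟩ r
      exact ⟨⟨r * s, t, by simp only [mul_assoc]⟩, ⟨s, t * r, by simp only [mul_assoc]⟩⟩)
    rcases h with h | h
    · have : f ∈ ({0} : Set T) := by
        rw [← h]; exact ⟨f, f, by rw [hf, hf]⟩
      exact absurd this hf0
    · have : e ∈ (Set.univ : Set T) := Set.mem_univ e
      rw [← h] at this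
      exact this
  obtain ⟨s, t, hst⟩ := hmem
  set a := e * s * f with ha
  have hea : e * a = a := by rw [ha, ← mul_assoc, ← mul_assoc, he]
  have haf : a * f = a := by rw [ha, mul_assoc, hf]
  have hab : a * (t * e) = e := by
    calc a * (t * e) = e * (s * f * t) * e := by rw [ha]; simp only [mul_assoc]
      _ = e := by rw [hst, he, he]
  have haa : a * a⁻¹ = e := by
    have h1 : a * a⁻¹ * e = e := by
      calc a * a⁻¹ * e = a * a⁻¹ * a * (t * e) := by rw [mul_assoc _ a, hab]
        _ = e := by rw [mul_inv_mul, hab]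
    rw [← h1, idem_comm (idem_mul_inv a) he, ← mul_assoc, hea]
  have hg : a⁻¹ * a * f = a⁻¹ * a := by rw [mul_assoc, haf]
  have hge : a⁻¹ * a = e := by
    rw [← haa]
    apply stable
    rw [haa, ← hg, mul_assoc, hfe]
  rw [hge, hef] at hg
  exact hg

theorem IsZeroSimple.eq_of_mul_eq (hT : IsZeroSimple T) {f x : T} (hf0 : f ≠ 0) (hf : f * f = f)
    (hxf : x * f = f) (hfx : f * x = f) : x = f := by
  have hfx' : f * x⁻¹ = f := by
    have := congrArg (·⁻¹) hxf
    simpa only [mul_inv_rev', inv_of_idem hf] using this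
  have h1 : f = x * x⁻¹ :=
    hT.idem_eq (idem_mul_inv x) hf hf0 (by rw [← mul_assoc, hfx, hfx'])
  calc x = x * x⁻¹ * x := (mul_inv_mul x).symm
    _ = f := by rw [← h1, hfx]

/-- A homomorphism is non-trivial if it is not constant. -/
def NonTrivialHom {S T : Type*} [Mul S] [Mul T] (f : S →ₙ* T) : Prop :=
  ∃ s t : S, f s ≠ f t

theorem NonTrivialHom.map_zero {S : Type*} [SemigroupWithZero S] (hT : IsZeroSimple T)
    {f : S →ₙ* T} (hf : NonTrivialHom f) : f 0 = 0 := by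
  by_contra h0
  have key : ∀ s, f s = f 0 := fun s => hT.eq_of_mul_eq h0 (by rw [← map_mul, zero_mul])
    (by rw [← map_mul, mul_zero]) (by rw [← map_mul, zero_mul])
  obtain ⟨s, t, hst⟩ := hf
  exact hst (by rw [key s, key t])

theorem NonTrivialHom.comp {S R : Type*} [SemigroupWithZero S] [SemigroupWithZero R] [Inv R]
    [IsInverseSemigroup R] [TopologicalSpace R] [ContinuousMul R] [ContinuousInv R] [T2Space R]
    [CountablyCompactSpace R] (hT : IsZeroSimple T) (hR : IsZeroSimple R) {f : S →ₙ* T}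
    {g : T →ₙ* R} (hf : NonTrivialHom f) (hg : NonTrivialHom g) : NonTrivialHom (g.comp f) := by
  have hf0 := hf.map_zero hT
  have hg0 := hg.map_zero hR
  by_contra h
  have hall : ∀ s, g (f s) = 0 := fun s => by
    by_contra hs
    exact h ⟨s, 0, by simpa [hf0, hg0] using hs⟩
  rcases hT.2 {t | g t = 0} ⟨0, hg0⟩ (fun a ha s => by
    have ha' : g a = 0 := ha
    exact ⟨by simp [ha'], by simp [ha']⟩) with h1 | h1
  · obtain ⟨s, t, hst⟩ := hf
    have hz : ∀ s, f s = 0 := fun s => by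
      have : f s ∈ {t | g t = 0} := hall s
      rw [h1] at this
      exact this
    exact hst (by rw [hz s, hz t])
  · obtain ⟨s, t, hst⟩ := hg
    have hz : ∀ s, g s = 0 := fun s => by
      have : s ∈ {t | g t = 0} := by rw [h1]; trivial
      exact this
    exact hst (by rw [hz s, hz t])

end NonTrivial

/-! ## The category of countably compact `0`-simple topological inverse semigroups -/

/-- A (Hausdorff) countably compact `0`-simple topological inverse semigroup. -/
structure CCZeroSimpleInv : Type (u + 1) where
  carrier : Type u
  [semigroup : SemigroupWithZero carrier]
  [inv : Inv carrier]
  [isInverse : IsInverseSemigroup carrier]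
  [top : TopologicalSpace carrier]
  [continuousMul : ContinuousMul carrier]
  [continuousInv : ContinuousInv carrier]
  [t2 : T2Space carrier]
  [countablyCompact : CountablyCompactSpace carrier]
  zeroSimple : IsZeroSimple carrier

attribute [instance] CCZeroSimpleInv.semigroup CCZeroSimpleInv.inv CCZeroSimpleInv.isInverse
  CCZeroSimpleInv.top CCZeroSimpleInv.continuousMul CCZeroSimpleInv.continuousInv
  CCZeroSimpleInv.t2 CCZeroSimpleInv.countablyCompact

/-- Non-trivial continuous (semigroup) homomorphisms. -/
@[ext]
structure CCZeroSimpleInv.Hom (S T : CCZeroSimpleInv.{u}) where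
  hom : S.carrier →ₙ* T.carrier
  continuous : Continuous hom
  nontrivial : NonTrivialHom hom

instance : Category CCZeroSimpleInv.{u} where
  Hom := CCZeroSimpleInv.Hom
  id S :=
    { hom := MulHom.id S.carrier
      continuous := continuous_id
      nontrivial := by
        obtain ⟨a, b, hab⟩ := S.zeroSimple.1
        exact ⟨a * b, 0, hab⟩ }
  comp {S T R} f g :=
    { hom := g.hom.comp f.hom
      continuous := g.continuous.comp f.continuous
      nontrivial := f.nontrivial.comp T.zeroSimple R.zeroSimple g.nontrivial }

/-- The category of (Hausdorff) compact `0`-simple topological inverse semigroups and non-trivial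
continuous homomorphisms. -/
abbrev CompactZeroSimpleInv : Type (u + 1) :=
  ObjectProperty.FullSubcategory (fun S : CCZeroSimpleInv.{u} => CompactSpace S.carrier)

/-! ## The category of pairs (topological group, finite set) -/

/-- A pair `(G, I)` of a (Hausdorff) countably compact topological group and a non-empty finite
set. -/
structure CCGroupPair : Type (u + 1) where
  group : Type u
  index : Type u
  [isGroup : Group group]
  [top : TopologicalSpace group]
  [topGroup : IsTopologicalGroup group]
  [t2 : T2Space group]
  [countablyCompact : CountablyCompactSpace group]
  [finite : Finite index]
  [nonempty : Nonempty index]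

attribute [instance] CCGroupPair.isGroup CCGroupPair.top CCGroupPair.topGroup CCGroupPair.t2
  CCGroupPair.countablyCompact CCGroupPair.finite CCGroupPair.nonempty

/-- A morphism `(G, I) ⟶ (H, J)` is a triple `(h, u, φ)` of a continuous homomorphism `h : G → H`,
a map `u : I → H` and an injective map `φ : I → J`. -/
@[ext]
structure CCGroupPair.Hom (X Y : CCGroupPair.{u}) where
  h : X.group →ₜ* Y.group
  u : X.index → Y.group
  φ : X.index ↪ Y.index

instance : Category CCGroupPair.{u} where
  Hom := CCGroupPair.Hom
  id X := ⟨ContinuousMonoidHom.id X.group, fun _ => 1, Function.Embedding.refl X.index⟩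
  comp f g := ⟨g.h.comp f.h, fun α => g.u (f.φ α) * g.h (f.u α), f.φ.trans g.φ⟩
  id_comp f := CCGroupPair.Hom.ext rfl (by funext α; simp) rfl
  comp_id f := CCGroupPair.Hom.ext rfl (by funext α; simp) rfl
  assoc f g k := CCGroupPair.Hom.ext rfl (by funext α; simp [mul_assoc]) rfl

/-- The category of pairs of a (Hausdorff) compact topological group and a non-empty finite set. -/
abbrev CompactGroupPair : Type (u + 1) :=
  ObjectProperty.FullSubcategory (fun X : CCGroupPair.{u} => CompactSpace X.group)

/-! ## The topological Brandt semigroup of a topological group -/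

/-- The underlying set `(I × G × I) ∪ {0}` of the Brandt semigroup `B_I(G)` of a group `G`. It is
the Brandt `λ⁰`-extension, `λ = |I|`, of the group with adjoined zero `G⁰`, whose non-zero elements
are the triples `(α, g, β)` with `g` a non-zero element of `G⁰`. -/
inductive Brandt (I G : Type u) : Type u
  | zero : Brandt I G
  | elt (α : I) (g : G) (β : I) : Brandt I G

namespace Brandt

section Algebra

variable {I G : Type u}

open Classical in
/-- `(α, a, β) (γ, b, δ)` is `(α, a b, δ)` if `β = γ` and `0` otherwise. -/
noncomputable instance [Mul G] : Mul (Brandt I G) where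
  mul
    | elt α a β, elt γ b δ => if β = γ then elt α (a * b) δ else zero
    | _, _ => zero

instance : Zero (Brandt I G) := ⟨zero⟩

instance [Inv G] : Inv (Brandt I G) where
  inv
    | zero => zero
    | elt α a β => elt β a⁻¹ α

theorem zero_eq : (zero : Brandt I G) = 0 := rfl

theorem elt_ne_zero (α : I) (g : G) (β : I) : elt α g β ≠ 0 := nofun

theorem range_union :
    (⋃ p : I × I, Set.range fun g : G => elt p.1 g p.2) ∪ {0} = (Set.univ : Set (Brandt I G)) := by
  refine Set.eq_univ_of_forall fun x => ?_
  rcases x with _ | ⟨α, a, β⟩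
  · exact Or.inr rfl
  · exact Or.inl (Set.mem_iUnion.2 ⟨(α, β), a, rfl⟩)

theorem inv_elt [Inv G] (α : I) (g : G) (β : I) : (elt α g β)⁻¹ = elt β g⁻¹ α := rfl

theorem inv_zero' [Inv G] : (0 : Brandt I G)⁻¹ = 0 := rfl

variable [Group G]

theorem zero_mul' (x : Brandt I G) : 0 * x = 0 := by cases x <;> rfl

theorem mul_zero' (x : Brandt I G) : x * 0 = 0 := by cases x <;> rfl

theorem elt_mul_elt (α β δ : I) (a b : G) : elt α a β * elt β b δ = elt α (a * b) δ :=
  if_pos rfl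

theorem elt_mul_elt_of_ne {α β γ δ : I} (a b : G) (h : β ≠ γ) : elt α a β * elt γ b δ = 0 :=
  if_neg h

noncomputable instance : SemigroupWithZero (Brandt I G) where
  zero_mul := zero_mul'
  mul_zero := mul_zero'
  mul_assoc x y z := by
    rcases x with _ | ⟨α, a, β⟩
    · simp only [zero_eq, zero_mul']
    rcases y with _ | ⟨γ, b, δ⟩
    · simp only [zero_eq, zero_mul', mul_zero']
    rcases z with _ | ⟨ε, c, ζ⟩
    · simp only [zero_eq, mul_zero']
    by_cases h1 : β = γ
    · subst h1
      by_cases h2 : δ = ε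
      · subst h2
        simp only [elt_mul_elt, mul_assoc]
      · simp only [elt_mul_elt, elt_mul_elt_of_ne _ _ h2, mul_zero']
    · by_cases h2 : δ = ε
      · subst h2
        simp only [elt_mul_elt, elt_mul_elt_of_ne _ _ h1, zero_mul']
      · simp only [elt_mul_elt_of_ne _ _ h1, elt_mul_elt_of_ne _ _ h2, mul_zero', zero_mul']

instance : IsInverseSemigroup (Brandt I G) where
  mul_inv_mul a := by
    rcases a with _ | ⟨α, a, β⟩
    · rfl
    · simp only [inv_elt, elt_mul_elt, mul_inv_cancel, one_mul]
  inv_mul_inv a := by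
    rcases a with _ | ⟨α, a, β⟩
    · rfl
    · simp only [inv_elt, elt_mul_elt, inv_mul_cancel, one_mul]
  eq_inv a b h1 h2 := by
    rcases a with _ | ⟨α, a, β⟩
    · rw [zero_eq, mul_zero', zero_mul'] at h2
      rw [zero_eq, inv_zero', h2]
    rcases b with _ | ⟨γ, b, δ⟩
    · rw [zero_eq, mul_zero', zero_mul'] at h1
      exact absurd h1.symm (elt_ne_zero _ _ _)
    by_cases hβ : β = γ
    · subst hβ
      by_cases hα : δ = α
      · subst hα
        simp only [elt_mul_elt, elt.injEq, true_and, and_true] at h1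
        have hab : a * b = 1 := by simpa using h1
        rw [inv_elt, eq_inv_of_mul_eq_one_right hab]
      · rw [elt_mul_elt, elt_mul_elt_of_ne _ _ hα] at h1
        exact absurd h1.symm (elt_ne_zero _ _ _)
    · rw [elt_mul_elt_of_ne _ _ hβ, zero_mul'] at h1
      exact absurd h1.symm (elt_ne_zero _ _ _)

theorem isZeroSimple [Nonempty I] : IsZeroSimple (Brandt I G) := by
  obtain ⟨ι⟩ := ‹Nonempty I›
  refine ⟨⟨elt ι 1 ι, elt ι 1 ι, by rw [elt_mul_elt]; exact elt_ne_zero _ _ _⟩,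
    fun J hJ hI => ?_⟩
  by_cases h : ∃ α g β, elt α g β ∈ J
  · right
    obtain ⟨α, g, β, hmem⟩ := h
    refine Set.eq_univ_of_forall fun x => ?_
    rcases x with _ | ⟨γ, b, δ⟩
    · have := (hI _ hmem 0).1
      rwa [zero_mul'] at this
    · have := (hI _ (hI _ hmem (elt γ (b * g⁻¹) α)).1 (elt β 1 δ)).2
      simpa [elt_mul_elt] using this
  · left
    push Not at h
    refine Set.eq_singleton_iff_nonempty_unique_mem.2 ⟨hJ, fun x hx => ?_⟩
    rcases x with _ | ⟨γ, b, δ⟩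
    · rfl
    · exact absurd hx (h _ _ _)

end Algebra

section Topology

variable {I G : Type u} [TopologicalSpace G]

/-- A set is open iff its trace on each copy `G_{αβ} = {(α, g, β) | g ∈ G}` of `G` is open. So all
the copies of `G` are open subspaces carrying the topology of `G`, and `0` is an isolated point. -/
instance : TopologicalSpace (Brandt I G) :=
  ⨆ (α : I) (β : I), TopologicalSpace.coinduced (fun g => elt α g β) inferInstance

theorem isOpen_iff {U : Set (Brandt I G)} :
    IsOpen U ↔ ∀ α β, IsOpen ((fun g => elt α g β) ⁻¹' U) := by
  simp only [isOpen_iSup_iff, isOpen_coinduced]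

theorem continuous_iff {X : Type*} [TopologicalSpace X] {f : Brandt I G → X} :
    Continuous f ↔ ∀ α β, Continuous fun g => f (elt α g β) := by
  simp only [continuous_def, isOpen_iff, Set.preimage_preimage]
  exact ⟨fun h α β s hs => h s hs α β, fun h s hs α β => h α β s hs⟩

theorem continuous_elt (α β : I) : Continuous fun g : G => elt α g β :=
  continuous_iff.1 continuous_id α β

theorem isOpenEmbedding_elt (α β : I) : IsOpenEmbedding fun g : G => elt α g β := by
  refine .of_continuous_injective_isOpenMap (continuous_elt α β)
    (fun g g' h => by simpa using h) fun U hU => isOpen_iff.2 fun γ δ => ?_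
  by_cases h : α = γ ∧ β = δ
  · obtain ⟨rfl, rfl⟩ := h
    convert hU using 1
    ext g
    simp
  · convert isOpen_empty using 1
    ext g
    simp only [Set.mem_preimage, Set.mem_image, elt.injEq, Set.mem_empty_iff_false, iff_false]
    rintro ⟨_, -, h1, -, h2⟩
    exact h ⟨h1, h2⟩

theorem nhds_elt (α β : I) (g : G) : 𝓝 (elt α g β) = map (fun g => elt α g β) (𝓝 g) :=
  ((isOpenEmbedding_elt α β).map_nhds_eq g).symm

theorem nhds_zero : 𝓝 (0 : Brandt I G) = pure 0 := by
  refine le_antisymm (le_pure_iff.2 (IsOpen.mem_nhds (isOpen_iff.2 fun α β => ?_) rfl))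
    (pure_le_nhds 0)
  convert isOpen_empty using 1
  ext g
  simp [elt_ne_zero]

instance [T2Space G] : T2Space (Brandt I G) := by
  have h0 : ∀ (α : I) (g : G) (β : I), Disjoint (𝓝 (0 : Brandt I G)) (𝓝 (elt α g β)) := by
    intro α g β
    rw [nhds_zero, nhds_elt, Filter.disjoint_iff]
    exact ⟨{0}, rfl, {0}ᶜ, Filter.mem_map.2 (Filter.univ_mem' fun _ => elt_ne_zero _ _ _),
      disjoint_compl_right⟩
  refine t2Space_iff_disjoint_nhds.2 fun x y hxy => ?_
  rcases x with _ | ⟨α, a, β⟩ <;> rcases y with _ | ⟨γ, b, δ⟩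
  · exact absurd rfl hxy
  · exact h0 γ b δ
  · exact (h0 α a β).symm
  · rw [nhds_elt, nhds_elt]
    by_cases h : α = γ ∧ β = δ
    · obtain ⟨rfl, rfl⟩ := h
      rw [disjoint_map (isOpenEmbedding_elt α β).injective, disjoint_nhds_nhds]
      exact fun h => hxy (by rw [h])
    · refine Filter.disjoint_iff.2 ⟨_, Filter.range_mem_map, _, Filter.range_mem_map,
        Set.disjoint_left.2 ?_⟩
      rintro _ ⟨_, rfl⟩ ⟨_, h'⟩
      simp only [elt.injEq] at h'
      exact h ⟨h'.1.symm, h'.2.2.symm⟩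

instance [Inv G] [ContinuousInv G] : ContinuousInv (Brandt I G) where
  continuous_inv := continuous_iff.2 fun α β => (continuous_elt β α).comp continuous_inv

instance [Group G] [ContinuousMul G] : ContinuousMul (Brandt I G) where
  continuous_mul := continuous_iff_continuousAt.2 fun ⟨x, y⟩ => by
    rcases x with _ | ⟨α, a, β⟩ <;> rcases y with _ | ⟨γ, b, δ⟩
    · rw [ContinuousAt, nhds_prod_eq, zero_eq, nhds_zero, pure_prod, tendsto_map'_iff, zero_mul']
      simp only [Function.comp_def, zero_mul']
      exact tendsto_const_nhds
    · rw [ContinuousAt, nhds_prod_eq, zero_eq, nhds_zero, pure_prod, tendsto_map'_iff, zero_mul']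
      simp only [Function.comp_def, zero_mul']
      exact tendsto_const_nhds
    · rw [ContinuousAt, nhds_prod_eq, zero_eq, nhds_zero, prod_pure, tendsto_map'_iff, mul_zero']
      simp only [Function.comp_def, mul_zero']
      exact tendsto_const_nhds
    · rw [ContinuousAt, nhds_prod_eq, nhds_elt, nhds_elt, prod_map_map_eq, tendsto_map'_iff,
        ← nhds_prod_eq]
      by_cases h : β = γ
      · subst h
        simp only [Function.comp_def, elt_mul_elt]
        exact ((continuous_elt α δ).comp continuous_mul).tendsto (a, b)
      · simp only [Function.comp_def, elt_mul_elt_of_ne _ _ h]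
        exact tendsto_const_nhds

instance [Finite I] [CompactSpace G] : CompactSpace (Brandt I G) where
  isCompact_univ := by
    rw [← range_union]
    exact (isCompact_iUnion fun p : I × I => isCompact_range (continuous_elt p.1 p.2)).union
      isCompact_singleton

instance [Finite I] [CountablyCompactSpace G] : CountablyCompactSpace (Brandt I G) where
  isCountablyCompact_univ := by
    rw [← range_union]
    refine (isCountablyCompact_iUnion fun p : I × I => ?_).union isCountablyCompact_singleton
    rw [← Set.image_univ]
    exact CountablyCompactSpace.isCountablyCompact_univ.image (continuous_elt p.1 p.2)

end Topology

end Brandt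

/-! ## The functor `B` -/

/-- The topological Brandt semigroup of a countably compact topological group. -/
noncomputable def CCGroupPair.brandt (X : CCGroupPair.{u}) : CCZeroSimpleInv.{u} where
  carrier := Brandt X.index X.group
  zeroSimple := Brandt.isZeroSimple

/-- `B(h, u, φ)` maps `(α, g, β)` to `(φ α, u α * h g * (u β)⁻¹, φ β)` and `0` to `0`. -/
def CCGroupPair.Hom.brandtFun {X Y : CCGroupPair.{u}} (f : X ⟶ Y) :
    Brandt X.index X.group → Brandt Y.index Y.group
  | .zero => .zero
  | .elt α g β => .elt (f.φ α) (f.u α * f.h g * (f.u β)⁻¹) (f.φ β)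

theorem CCGroupPair.Hom.brandtFun_mul {X Y : CCGroupPair.{u}} (f : X ⟶ Y)
    (x y : Brandt X.index X.group) : f.brandtFun (x * y) = f.brandtFun x * f.brandtFun y := by
  rcases x with _ | ⟨α, a, β⟩
  · rfl
  rcases y with _ | ⟨γ, b, δ⟩
  · rfl
  by_cases h : β = γ
  · subst h
    simp only [Brandt.elt_mul_elt, brandtFun, map_mul]
    congr 1
    group
  · rw [Brandt.elt_mul_elt_of_ne _ _ h]
    simp only [brandtFun]
    rw [Brandt.elt_mul_elt_of_ne _ _ (f.φ.injective.ne h)]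
    rfl

/-- `B(h, u, φ)` as a non-trivial continuous homomorphism. -/
noncomputable def CCGroupPair.Hom.brandtMap {X Y : CCGroupPair.{u}} (f : X ⟶ Y) :
    X.brandt ⟶ Y.brandt where
  hom :=
    { toFun := f.brandtFun
      map_mul' := f.brandtFun_mul }
  continuous := Brandt.continuous_iff.2 fun α β =>
    (Brandt.continuous_elt (f.φ α) (f.φ β)).comp
      ((continuous_const.mul f.h.continuous_toFun).mul continuous_const)
  nontrivial :=
    ⟨.elt (Classical.arbitrary _) 1 (Classical.arbitrary _), .zero, Brandt.elt_ne_zero _ _ _⟩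

/-- The functor `B` from pairs (countably compact topological group, non-empty finite set) to
countably compact `0`-simple topological inverse semigroups. -/
noncomputable def brandtFunctor : CCGroupPair.{u} ⥤ CCZeroSimpleInv.{u} where
  obj := CCGroupPair.brandt
  map := CCGroupPair.Hom.brandtMap
  map_id X := by
    refine CCZeroSimpleInv.Hom.ext (MulHom.ext fun x => ?_)
    rcases x with _ | ⟨α, a, β⟩
    · rfl
    · change Brandt.elt α (1 * a * 1⁻¹) β = Brandt.elt α a β
      simp
  map_comp {X Y Z} f g := by
    refine CCZeroSimpleInv.Hom.ext (MulHom.ext fun x => ?_)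
    rcases x with _ | ⟨α, a, β⟩
    · rfl
    · change Brandt.elt (g.φ (f.φ α)) (g.u (f.φ α) * g.h (f.u α) * g.h (f.h a) *
          (g.u (f.φ β) * g.h (f.u β))⁻¹) (g.φ (f.φ β)) =
        Brandt.elt (g.φ (f.φ α)) (g.u (f.φ α) * g.h (f.u α * f.h a * (f.u β)⁻¹) *
          (g.u (f.φ β))⁻¹) (g.φ (f.φ β))
      congr 1
      simp [mul_assoc]

/-- The restriction of the functor `B` to compact topological groups. -/
noncomputable def compactBrandtFunctor : CompactGroupPair.{u} ⥤ CompactZeroSimpleInv.{u} :=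
  ObjectProperty.lift _ (ObjectProperty.ι _ ⋙ brandtFunctor) fun X =>
    haveI : CompactSpace X.obj.group := X.property
    inferInstanceAs (CompactSpace (Brandt X.obj.index X.obj.group))

/-!
Let `S` be a countably compact `0`-simple topological inverse semigroup. By `IsZeroSimple.idem_eq`
every non-zero idempotent of `S` is primitive, so distinct non-zero idempotents are orthogonal
(`IsZeroSimple.idem_orthogonal`), and `S \ {0}` is the disjoint union of the closed cells
`{x | x * x⁻¹ = e, x⁻¹ * x = f}` indexed by pairs of non-zero idempotents, each of them non-empty
(`IsZeroSimple.cell_nonempty`).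

There are only finitely many non-zero idempotents (`IsZeroSimple.finite_nonzeroIdem`). Otherwise
pick distinct ones `e n` and elements `a n` with `a n * (a n)⁻¹ = e₀` and `(a n)⁻¹ * a n = e n`,
and let `y` be the limit of `a` along a free ultrafilter. Then `y⁻¹ * y` is the limit of the
pairwise orthogonal idempotents `e n`, hence is `0`; so `y = 0`, although `y * y⁻¹ = e₀ ≠ 0`.
Consequently `0` is isolated and the cells are clopen. Fixing an idempotent `e`, the group
`G = cell e e` and an element `r f` of each `cell f e`, the map `(f, g, f') ↦ r f * g * (r f')⁻¹` is
an isomorphism from the Brandt semigroup of `G` over the set of non-zero idempotents onto `S`.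

For fullness, a non-trivial homomorphism `F` between Brandt semigroups vanishes exactly at `0`. It
sends the idempotent `(α, 1, α)` to an idempotent `(φ α, 1, φ α)`, so it sends `(α, g, β)` to some
`(φ α, k α g β, φ β)` with `k` multiplicative. For a fixed `ι`, put `h g = k ι g ι` and
`u α = k α 1 ι`; then `F` is the image of `(h, u, φ)`.
-/

/-! ### Cells of an inverse semigroup and maximal subgroups -/

namespace IsInverseSemigroup

section Cell

variable {S : Type*} [Semigroup S] [Inv S]

/-- The elements `x` with left unit `x * x⁻¹ = e` and right unit `x⁻¹ * x = f`. For
idempotents `e` and `f` this is the intersection of the `ℛ`-class of `e` and the `ℒ`-class of `f`.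
-/
def cell (e f : S) : Set S := {x | x * x⁻¹ = e ∧ x⁻¹ * x = f}

theorem isClosed_cell [TopologicalSpace S] [ContinuousMul S] [ContinuousInv S] [T2Space S]
    (e f : S) : IsClosed (cell e f) :=
  (isClosed_eq (continuous_id.mul continuous_inv) continuous_const).inter
    (isClosed_eq (continuous_inv.mul continuous_id) continuous_const)

variable [IsInverseSemigroup S] {e f g x y : S}

theorem left_mul_of_mem_cell (hx : x ∈ cell e f) : e * x = x := by
  rw [← hx.1, mul_inv_mul]

theorem mul_right_of_mem_cell (hx : x ∈ cell e f) : x * f = x := by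
  rw [← hx.2, ← mul_assoc, mul_inv_mul]

theorem inv_mem_cell (hx : x ∈ cell e f) : x⁻¹ ∈ cell f e := by
  refine ⟨?_, ?_⟩
  · rw [inv_inv', hx.2]
  · rw [inv_inv', hx.1]

theorem mul_mem_cell (hx : x ∈ cell e f) (hy : y ∈ cell f g) : x * y ∈ cell e g := by
  refine ⟨?_, ?_⟩
  · calc x * y * (x * y)⁻¹ = x * (y * y⁻¹) * x⁻¹ := by
          rw [mul_inv_rev']; simp only [mul_assoc]
      _ = e := by rw [hy.1, mul_right_of_mem_cell hx, hx.1]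
  · calc (x * y)⁻¹ * (x * y) = y⁻¹ * (x⁻¹ * x * y) := by
          rw [mul_inv_rev']; simp only [mul_assoc]
      _ = g := by rw [hx.2, left_mul_of_mem_cell hy, hy.2]

theorem self_mem_cell (he : e * e = e) : e ∈ cell e e := by
  rw [cell, Set.mem_ofPred_eq, inv_of_idem he, and_self, he]

end Cell

/-- The type of non-zero idempotents. -/
def NonzeroIdem (S : Type*) [SemigroupWithZero S] : Type _ := {e : S // e * e = e ∧ e ≠ 0}

section NonzeroIdem

variable {S : Type*} [SemigroupWithZero S] [Inv S]

theorem ne_zero_of_mem_cell {e : NonzeroIdem S} {f x : S} (hx : x ∈ cell e.1 f) : x ≠ 0 := by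
  rintro rfl
  exact e.2.2 (by rw [← hx.1, zero_mul])

variable [IsInverseSemigroup S]

/-- The left unit `x * x⁻¹` of a non-zero element. -/
def leftUnit {x : S} (hx : x ≠ 0) : NonzeroIdem S :=
  ⟨x * x⁻¹, idem_mul_inv x, fun h => hx (by rw [← mul_inv_mul x, h, zero_mul])⟩

/-- The right unit `x⁻¹ * x` of a non-zero element. -/
def rightUnit {x : S} (hx : x ≠ 0) : NonzeroIdem S :=
  ⟨x⁻¹ * x, idem_inv_mul x, fun h => hx (by rw [← mul_inv_mul x, mul_assoc, h, mul_zero])⟩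

theorem _root_.IsZeroSimple.nonempty_nonzeroIdem (hS : IsZeroSimple S) :
    Nonempty (NonzeroIdem S) := by
  obtain ⟨a, b, hab⟩ := hS.1
  exact ⟨leftUnit hab⟩

end NonzeroIdem

/-- The maximal subgroup with identity `e`, with the subspace topology if `S` is a topological
space. -/
def MaxSubgroup {S : Type*} [SemigroupWithZero S] [Inv S] (e : NonzeroIdem S) : Type _ :=
  ↥(cell e.1 e.1)

section MaxSubgroup

variable {S : Type*} [SemigroupWithZero S] [Inv S] [IsInverseSemigroup S] (e : NonzeroIdem S)

noncomputable instance : Group (MaxSubgroup e) where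
  mul x y := ⟨x.1 * y.1, mul_mem_cell x.2 y.2⟩
  one := ⟨e.1, self_mem_cell e.2.1⟩
  inv x := ⟨x.1⁻¹, inv_mem_cell x.2⟩
  mul_assoc x y z := Subtype.ext (mul_assoc x.1 y.1 z.1)
  one_mul x := Subtype.ext (left_mul_of_mem_cell x.2)
  mul_one x := Subtype.ext (mul_right_of_mem_cell x.2)
  inv_mul_cancel x := Subtype.ext x.2.2

variable [TopologicalSpace S]

instance : TopologicalSpace (MaxSubgroup e) := inferInstanceAs (TopologicalSpace ↥(cell e.1 e.1))

instance [ContinuousMul S] [ContinuousInv S] : IsTopologicalGroup (MaxSubgroup e) where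
  continuous_mul := Continuous.subtype_mk ((continuous_subtype_val.comp continuous_fst).mul
    (continuous_subtype_val.comp continuous_snd)) _
  continuous_inv := Continuous.subtype_mk continuous_subtype_val.inv _

instance [T2Space S] : T2Space (MaxSubgroup e) := inferInstanceAs (T2Space ↥(cell e.1 e.1))

variable [ContinuousMul S] [ContinuousInv S] [T2Space S]

instance [CountablyCompactSpace S] : CountablyCompactSpace (MaxSubgroup e) :=
  isCountablyCompact_iff_countablyCompactSpace.1 (isClosed_cell e.1 e.1).isCountablyCompact

instance [CompactSpace S] : CompactSpace (MaxSubgroup e) :=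
  isCompact_iff_compactSpace.1 (isClosed_cell e.1 e.1).isCompact

end MaxSubgroup

end IsInverseSemigroup

/-! ### Idempotents of countably compact `0`-simple inverse semigroups -/

namespace IsZeroSimple

open IsInverseSemigroup

section Structure

variable {T : Type*} [SemigroupWithZero T] [Inv T] [IsInverseSemigroup T] [TopologicalSpace T]
  [ContinuousMul T] [ContinuousInv T] [T2Space T] [CountablyCompactSpace T]

theorem idem_orthogonal (hT : IsZeroSimple T) {e f : T} (he : e * e = e) (hf : f * f = f)
    (hef : e ≠ f) : e * f = 0 := by
  by_contra h0
  have hi := idem_mul he hf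
  refine hef ((hT.idem_eq he hi h0 ?_).symm.trans (hT.idem_eq hf hi h0 ?_))
  · rw [mul_assoc, idem_comm hf he, ← mul_assoc, he]
  · rw [mul_assoc, hf]

/-- Any two non-zero idempotents are `𝒟`-equivalent: `e` lies in the ideal generated by `f`, say
`e = s * f * t`, and then `e * s * f` has left unit `e` and right unit `f`. -/
theorem cell_nonempty (hT : IsZeroSimple T) (e f : NonzeroIdem T) : (cell e.1 f.1).Nonempty := by
  obtain ⟨e, he, he0⟩ := e
  obtain ⟨f, hf, hf0⟩ := f
  have hmem : ∃ s t : T, s * f * t = e := by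
    rcases hT.2 {x | ∃ s t : T, s * f * t = x} ⟨_, f, f, rfl⟩ (by
      rintro _ ⟨s, t, rfl⟩ r
      exact ⟨⟨r * s, t, by simp only [mul_assoc]⟩, ⟨s, t * r, by simp only [mul_assoc]⟩⟩)
      with h | h
    · have : f ∈ ({0} : Set T) := by
        rw [← h]; exact ⟨f, f, by rw [hf, hf]⟩
      exact absurd this hf0
    · have : e ∈ (Set.univ : Set T) := Set.mem_univ e
      rwa [← h] at this
  obtain ⟨s, t, hst⟩ := hmem
  have h0 : e * s * f ≠ 0 := fun h => he0 <| by
    calc e = e * (s * f * t) := by rw [hst, he]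
      _ = e * s * f * t := by simp only [mul_assoc]
      _ = 0 := by rw [h, zero_mul]
  have hea : e * (e * s * f) = e * s * f := by rw [← mul_assoc, ← mul_assoc, he]
  have haf : e * s * f * f = e * s * f := by rw [mul_assoc, hf]
  refine ⟨e * s * f, ?_, ?_⟩
  · refine hT.idem_eq he (leftUnit h0).2.1 (leftUnit h0).2.2 ?_
    change e * s * f * (e * s * f)⁻¹ * e = e * s * f * (e * s * f)⁻¹
    rw [idem_comm (idem_mul_inv _) he, ← mul_assoc, hea]
  · refine hT.idem_eq hf (rightUnit h0).2.1 (rightUnit h0).2.2 ?_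
    change (e * s * f)⁻¹ * (e * s * f) * f = (e * s * f)⁻¹ * (e * s * f)
    rw [mul_assoc, haf]

theorem finite_nonzeroIdem (hT : IsZeroSimple T) : Finite (NonzeroIdem T) := by
  by_contra hfin
  rw [not_finite_iff_infinite] at hfin
  let e : ℕ ↪ NonzeroIdem T := Infinite.natEmbedding _
  choose a ha using fun n => hT.cell_nonempty (e 0) (e n)
  obtain ⟨y, -, hy⟩ := IsCountablyCompact.seq_clusterPt
    (CountablyCompactSpace.isCountablyCompact_univ (E := T)) a (by simp)
  obtain ⟨U, hU, hay⟩ := mapClusterPt_iff_ultrafilter.1 hy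
  have hyy : y * y⁻¹ = (e 0).1 := by
    refine tendsto_nhds_unique (hay.mul hay.inv) ?_
    simp only [(ha _).1]
    exact tendsto_const_nhds
  have hlim : Tendsto (fun n => (e n).1) U (𝓝 (y⁻¹ * y)) := by
    simpa only [(ha _).2] using hay.inv.mul hay
  -- Passing to the limit in `e n * e m = 0`, first in `n` and then in `m`, gives `y⁻¹ * y = 0`.
  have horth : ∀ m, y⁻¹ * y * (e m).1 = 0 := fun m => by
    refine tendsto_nhds_unique (hlim.mul_const (e m).1) (tendsto_const_nhds.congr' ?_)
    filter_upwards [hU (eventually_gt_atTop m)] with n hn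
    refine (hT.idem_orthogonal (e n).2.1 (e m).2.1 fun h => ?_).symm
    exact hn.ne' (e.injective (Subtype.ext h))
  have hz : y⁻¹ * y * (y⁻¹ * y) = 0 := by
    refine tendsto_nhds_unique (hlim.const_mul (y⁻¹ * y)) ?_
    simp only [horth]
    exact tendsto_const_nhds
  have hy0 : y = 0 := by
    rw [idem_inv_mul] at hz
    rw [← mul_inv_mul y, mul_assoc, hz, mul_zero]
  exact (e 0).2.2 (by rw [← hyy, hy0, zero_mul])

theorem isOpen_singleton_zero (hT : IsZeroSimple T) : IsOpen ({0} : Set T) := by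
  have := hT.finite_nonzeroIdem
  rw [← isClosed_compl_iff]
  convert isClosed_iUnion_of_finite
    fun p : NonzeroIdem T × NonzeroIdem T => isClosed_cell p.1.1 p.2.1
  ext x
  simp only [Set.mem_compl_iff, Set.mem_singleton_iff, Set.mem_iUnion]
  exact ⟨fun hx => ⟨(leftUnit hx, rightUnit hx), rfl, rfl⟩,
    fun ⟨_, hp⟩ => ne_zero_of_mem_cell hp⟩

/-- The complement of a cell is the union of `{0}` and the finitely many other cells. -/
theorem isOpen_cell (hT : IsZeroSimple T) (e f : NonzeroIdem T) : IsOpen (cell e.1 f.1) := by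
  have := hT.finite_nonzeroIdem
  rw [← isClosed_compl_iff]
  convert (isClosed_singleton (x := (0 : T))).union (isClosed_iUnion_of_finite
    fun p : {p : NonzeroIdem T × NonzeroIdem T // p ≠ (e, f)} => isClosed_cell p.1.1.1 p.1.2.1)
  ext x
  simp only [Set.mem_compl_iff, Set.mem_union, Set.mem_singleton_iff, Set.mem_iUnion]
  constructor
  · intro hx
    refine or_iff_not_imp_left.2 fun h0 => ⟨⟨(leftUnit h0, rightUnit h0), fun h => hx ?_⟩, rfl, rfl⟩
    rw [Prod.mk.injEq] at h
    exact ⟨congrArg Subtype.val h.1, congrArg Subtype.val h.2⟩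
  · rintro (rfl | ⟨⟨p, hp⟩, hx⟩) hx'
    · exact ne_zero_of_mem_cell hx' rfl
    · exact hp (Prod.ext (Subtype.ext (hx.1.symm.trans hx'.1))
        (Subtype.ext (hx.2.symm.trans hx'.2)))

end Structure

/-! ### Coordinates on a countably compact `0`-simple inverse semigroup -/

section Coordinates

variable {T : Type u} [SemigroupWithZero T] [Inv T] {e : NonzeroIdem T}
  {r : NonzeroIdem T → T}

/-- The map `(f, g, f') ↦ r f * g * (r f')⁻¹`, `0 ↦ 0`, for a choice of `r f ∈ cell f e`. -/
def brandtToFun (e : NonzeroIdem T) (r : NonzeroIdem T → T) :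
    Brandt (NonzeroIdem T) (MaxSubgroup e) → T
  | .zero => 0
  | .elt f g f' => r f * g.1 * (r f')⁻¹

theorem continuous_brandtToFun [TopologicalSpace T] [ContinuousMul T]
    (e : NonzeroIdem T) (r : NonzeroIdem T → T) :
    Continuous (brandtToFun e r) :=
  Brandt.continuous_iff.2 fun _ _ =>
    (continuous_const.mul continuous_subtype_val).mul continuous_const

variable [IsInverseSemigroup T]

theorem conj_mem_cell (hr : ∀ f, r f ∈ cell f.1 e.1) (f f' : NonzeroIdem T) (g : MaxSubgroup e) :
    r f * g.1 * (r f')⁻¹ ∈ cell f.1 f'.1 :=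
  mul_mem_cell (mul_mem_cell (hr f) g.2) (inv_mem_cell (hr f'))

theorem unconj_mem_cell (hr : ∀ f, r f ∈ cell f.1 e.1) {f f' : NonzeroIdem T} {x : T}
    (hx : x ∈ cell f.1 f'.1) : (r f)⁻¹ * x * r f' ∈ cell e.1 e.1 :=
  mul_mem_cell (mul_mem_cell (inv_mem_cell (hr f)) hx) (hr f')

open Classical in
/-- The inverse of `brandtToFun`: `x ↦ (f, (r f)⁻¹ * x * r f', f')` with `f = x * x⁻¹` and
`f' = x⁻¹ * x`. -/
noncomputable def brandtInvFun (hr : ∀ f, r f ∈ cell f.1 e.1) (x : T) :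
    Brandt (NonzeroIdem T) (MaxSubgroup e) :=
  if hx : x = 0 then .zero
  else .elt (leftUnit hx) ⟨(r (leftUnit hx))⁻¹ * x * r (rightUnit hx),
    unconj_mem_cell hr ⟨rfl, rfl⟩⟩ (rightUnit hx)

theorem brandtInvFun_of_mem_cell (hr : ∀ f, r f ∈ cell f.1 e.1) {f f' : NonzeroIdem T} {x : T}
    (hx : x ∈ cell f.1 f'.1) :
    brandtInvFun hr x = .elt f ⟨(r f)⁻¹ * x * r f', unconj_mem_cell hr hx⟩ f' := by
  have h0 := ne_zero_of_mem_cell hx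
  obtain rfl : leftUnit h0 = f := Subtype.ext hx.1
  obtain rfl : rightUnit h0 = f' := Subtype.ext hx.2
  rw [brandtInvFun, dif_neg h0]

theorem brandtInvFun_zero (hr : ∀ f, r f ∈ cell f.1 e.1) : brandtInvFun hr 0 = 0 := dif_pos rfl

theorem brandtInvFun_brandtToFun (hr : ∀ f, r f ∈ cell f.1 e.1)
    (x : Brandt (NonzeroIdem T) (MaxSubgroup e)) : brandtInvFun hr (brandtToFun e r x) = x := by
  rcases x with _ | ⟨f, g, f'⟩
  · exact brandtInvFun_zero hr
  · refine (brandtInvFun_of_mem_cell hr (conj_mem_cell hr f f' g)).trans ?_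
    congr 1
    refine Subtype.ext ?_
    calc (r f)⁻¹ * (r f * g.1 * (r f')⁻¹) * r f' = ((r f)⁻¹ * r f) * g.1 * ((r f')⁻¹ * r f') := by
          simp only [mul_assoc]
      _ = g.1 := by
          rw [(hr f).2, (hr f').2, left_mul_of_mem_cell g.2, mul_right_of_mem_cell g.2]

theorem brandtToFun_brandtInvFun (hr : ∀ f, r f ∈ cell f.1 e.1) (x : T) :
    brandtToFun e r (brandtInvFun hr x) = x := by
  by_cases h0 : x = 0
  · rw [h0, brandtInvFun_zero]
    rfl
  · have hx : x ∈ cell (leftUnit h0).1 (rightUnit h0).1 := ⟨rfl, rfl⟩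
    rw [brandtInvFun_of_mem_cell hr hx]
    set f := leftUnit h0
    set f' := rightUnit h0
    calc r f * ((r f)⁻¹ * x * r f') * (r f')⁻¹ = (r f * (r f)⁻¹) * x * (r f' * (r f')⁻¹) := by
          simp only [mul_assoc]
      _ = x := by rw [(hr f).1, (hr f').1, left_mul_of_mem_cell hx, mul_right_of_mem_cell hx]

variable [TopologicalSpace T] [ContinuousMul T] [ContinuousInv T] [T2Space T]
  [CountablyCompactSpace T]

theorem brandtToFun_mul (hT : IsZeroSimple T) (hr : ∀ f, r f ∈ cell f.1 e.1)
    (x y : Brandt (NonzeroIdem T) (MaxSubgroup e)) :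
    brandtToFun e r (x * y) = brandtToFun e r x * brandtToFun e r y := by
  rcases x with _ | ⟨f₁, a, f₂⟩
  · rw [Brandt.zero_eq, zero_mul]
    exact (zero_mul _).symm
  rcases y with _ | ⟨f₃, b, f₄⟩
  · rw [Brandt.zero_eq, mul_zero]
    exact (mul_zero _).symm
  by_cases h : f₂ = f₃
  · subst h
    rw [Brandt.elt_mul_elt]
    change r f₁ * (a.1 * b.1) * (r f₄)⁻¹ = r f₁ * a.1 * (r f₂)⁻¹ * (r f₂ * b.1 * (r f₄)⁻¹)
    calc r f₁ * (a.1 * b.1) * (r f₄)⁻¹ = r f₁ * (a.1 * ((r f₂)⁻¹ * r f₂) * b.1) * (r f₄)⁻¹ := by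
          rw [(hr f₂).2, mul_right_of_mem_cell a.2]
      _ = _ := by simp only [mul_assoc]
  · rw [Brandt.elt_mul_elt_of_ne _ _ h]
    change 0 = r f₁ * a.1 * (r f₂)⁻¹ * (r f₃ * b.1 * (r f₄)⁻¹)
    rw [← mul_right_of_mem_cell (conj_mem_cell hr f₁ f₂ a),
      ← left_mul_of_mem_cell (conj_mem_cell hr f₃ f₄ b), mul_assoc, ← mul_assoc f₂.1,
      hT.idem_orthogonal f₂.2.1 f₃.2.1 fun h' => h (Subtype.ext h'), zero_mul, mul_zero]

theorem continuous_brandtInvFun (hT : IsZeroSimple T) (hr : ∀ f, r f ∈ cell f.1 e.1) :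
    Continuous (brandtInvFun hr) := by
  refine continuous_iff_continuousAt.2 fun x => ?_
  by_cases h0 : x = 0
  · have : 𝓝 x = pure x := by
      rw [h0]
      exact le_antisymm (le_pure_iff.2 (hT.isOpen_singleton_zero.mem_nhds rfl)) (pure_le_nhds 0)
    rw [ContinuousAt, this]
    exact tendsto_pure_nhds _ _
  · have hx : x ∈ cell (leftUnit h0).1 (rightUnit h0).1 := ⟨rfl, rfl⟩
    set f := leftUnit h0
    set f' := rightUnit h0
    refine ContinuousOn.continuousAt (s := cell f.1 f'.1) ?_ ((hT.isOpen_cell f f').mem_nhds hx)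
    rw [continuousOn_iff_continuous_domRestrict]
    have hrestr : (cell f.1 f'.1).domRestrict (brandtInvFun hr) = fun z => Brandt.elt f
        (⟨(r f)⁻¹ * z.1 * r f', unconj_mem_cell hr z.2⟩ : MaxSubgroup e) f' :=
      funext fun z => brandtInvFun_of_mem_cell hr z.2
    rw [hrestr]
    exact (Brandt.continuous_elt f f').comp (Continuous.subtype_mk
      ((continuous_const.mul continuous_subtype_val).mul continuous_const) _)

end Coordinates

end IsZeroSimple

/-! ### The functor is representative -/

namespace CCZeroSimpleInv

open IsInverseSemigroup

/-- A multiplicative homeomorphism is an isomorphism; bijectivity makes it non-trivial because a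
`0`-simple semigroup has at least two elements. -/
def isoMk {S T : CCZeroSimpleInv.{u}} (F : S.carrier →ₙ* T.carrier) (G : T.carrier → S.carrier)
    (hF : Continuous F) (hG : Continuous G) (hGF : ∀ x, G (F x) = x) (hFG : ∀ y, F (G y) = y) :
    S ≅ T where
  hom :=
    { hom := F
      continuous := hF
      nontrivial := by
        obtain ⟨a, b, hab⟩ := S.zeroSimple.1
        exact ⟨a * b, 0, fun h => hab (Function.LeftInverse.injective hGF h)⟩ }
  inv :=
    { hom :=
        { toFun := G
          map_mul' := fun x y => by
            rw [← hGF (G x * G y), map_mul, hFG, hFG] }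
      continuous := hG
      nontrivial := by
        obtain ⟨a, b, hab⟩ := T.zeroSimple.1
        exact ⟨a * b, 0, fun h => hab (Function.LeftInverse.injective hFG h)⟩ }
  hom_inv_id := Hom.ext (MulHom.ext hGF)
  inv_hom_id := Hom.ext (MulHom.ext hFG)

/-- A maximal subgroup of `S`, paired with the set of non-zero idempotents. -/
noncomputable def pair (S : CCZeroSimpleInv.{u}) (e : NonzeroIdem S.carrier) : CCGroupPair.{u} :=
  haveI := S.zeroSimple.finite_nonzeroIdem
  { group := MaxSubgroup e
    index := NonzeroIdem S.carrier
    nonempty := ⟨e⟩ }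

theorem nonempty_brandt_pair_iso (S : CCZeroSimpleInv.{u}) (e : NonzeroIdem S.carrier) :
    Nonempty ((S.pair e).brandt ≅ S) := by
  choose r hr using fun f => S.zeroSimple.cell_nonempty f e
  exact ⟨isoMk (S := (S.pair e).brandt)
    { toFun := IsZeroSimple.brandtToFun e r
      map_mul' := S.zeroSimple.brandtToFun_mul hr }
    (IsZeroSimple.brandtInvFun hr) (IsZeroSimple.continuous_brandtToFun e r)
    (S.zeroSimple.continuous_brandtInvFun hr) (IsZeroSimple.brandtInvFun_brandtToFun hr)
    (IsZeroSimple.brandtToFun_brandtInvFun hr)⟩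

end CCZeroSimpleInv

theorem brandtFunctor_essSurj : brandtFunctor.{u}.EssSurj where
  mem_essImage S := by
    obtain ⟨e⟩ := S.zeroSimple.nonempty_nonzeroIdem
    exact ⟨S.pair e, S.nonempty_brandt_pair_iso e⟩

theorem compactBrandtFunctor_essSurj : compactBrandtFunctor.{u}.EssSurj where
  mem_essImage S := by
    have : CompactSpace S.obj.carrier := S.property
    obtain ⟨e⟩ := S.obj.zeroSimple.nonempty_nonzeroIdem
    obtain ⟨i⟩ := S.obj.nonempty_brandt_pair_iso e
    exact ⟨⟨S.obj.pair e, inferInstanceAs (CompactSpace (IsInverseSemigroup.MaxSubgroup e))⟩,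
      ⟨ObjectProperty.isoMk _ i⟩⟩

/-! ### The functor is full -/

namespace Brandt

variable {I G : Type u} [Group G]

theorem eq_elt_one_of_idem {x : Brandt I G} (hx : x * x = x) (h0 : x ≠ 0) :
    ∃ α, x = elt α 1 α := by
  rcases x with _ | ⟨α, a, β⟩
  · exact absurd rfl h0
  by_cases h : β = α
  · subst h
    rw [elt_mul_elt] at hx
    simp only [elt.injEq, true_and, and_true, mul_eq_left] at hx
    exact ⟨β, by rw [hx]⟩
  · rw [elt_mul_elt_of_ne _ _ h] at hx
    exact absurd hx.symm h0

theorem eq_elt_of_mul {x : Brandt I G} {α β : I} (h0 : x ≠ 0) (hα : elt α 1 α * x = x)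
    (hβ : x * elt β 1 β = x) : ∃ g, x = elt α g β := by
  rcases x with _ | ⟨γ, a, δ⟩
  · exact absurd rfl h0
  by_cases h : α = γ
  · by_cases h' : δ = β
    · exact ⟨a, by rw [h, h']⟩
    · rw [elt_mul_elt_of_ne _ _ h'] at hβ
      exact absurd hβ.symm h0
  · rw [elt_mul_elt_of_ne _ _ h] at hα
    exact absurd hα.symm h0

end Brandt

/-- The kernel of a non-trivial homomorphism between `0`-simple semigroups is an ideal different
from the whole semigroup. -/
theorem CCZeroSimpleInv.Hom.eq_zero_of_map_eq_zero {S T : CCZeroSimpleInv.{u}} (F : S ⟶ T)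
    {x : S.carrier} (hx : F.hom x = 0) : x = 0 := by
  have hF0 := F.nontrivial.map_zero T.zeroSimple
  rcases S.zeroSimple.2 {s | F.hom s = 0} ⟨0, hF0⟩ (fun a ha s => by
    have ha' : F.hom a = 0 := ha
    exact ⟨by simp [ha'], by simp [ha']⟩) with h | h
  · have : x ∈ {s | F.hom s = 0} := hx
    rwa [h] at this
  · obtain ⟨s, t, hst⟩ := F.nontrivial
    have hz : ∀ s, F.hom s = 0 := fun s => by
      have : s ∈ {s | F.hom s = 0} := by rw [h]; trivial
      exact this
    exact absurd ((hz s).trans (hz t).symm) hst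

open Brandt in
theorem CCGroupPair.exists_brandtMap_eq {X Y : CCGroupPair.{u}} (F : X.brandt ⟶ Y.brandt) :
    ∃ f : X ⟶ Y, f.brandtMap = F := by
  let H : Brandt X.index X.group → Brandt Y.index Y.group := F.hom
  have hmul : ∀ x y, H (x * y) = H x * H y := fun x y => map_mul F.hom x y
  have hzero : H 0 = 0 := F.nontrivial.map_zero Y.brandt.zeroSimple
  have hne : ∀ α g β, H (elt α g β) ≠ 0 := fun α g β h =>
    elt_ne_zero α g β (F.eq_zero_of_map_eq_zero h)
  choose φ hφ using fun α => eq_elt_one_of_idem (x := H (elt α 1 α))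
    (by rw [← hmul, elt_mul_elt, mul_one]) (hne α 1 α)
  choose k hk using fun α g β => eq_elt_of_mul (x := H (elt α g β)) (α := φ α) (β := φ β)
    (hne α g β) (by rw [← hφ, ← hmul, elt_mul_elt, one_mul])
    (by rw [← hφ, ← hmul, elt_mul_elt, mul_one])
  have hφinj : Function.Injective φ := fun α β h => by
    by_contra hαβ
    have h1 := hmul (elt α 1 α) (elt β 1 β)
    rw [elt_mul_elt_of_ne _ _ hαβ, hzero, hφ, hφ, h, elt_mul_elt] at h1
    exact elt_ne_zero _ _ _ h1.symm
  have hkmul : ∀ α β γ a b, k α (a * b) γ = k α a β * k β b γ := fun α β γ a b => by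
    have h1 := hmul (elt α a β) (elt β b γ)
    rw [elt_mul_elt, hk, hk, hk, elt_mul_elt] at h1
    simpa using h1
  have hkone : ∀ α, k α 1 α = 1 := fun α => by
    have h1 := hkmul α α α 1 1
    rwa [mul_one, left_eq_mul] at h1
  -- `h` and `u` depend on the choice of a base point of the index set; `F` does not determine them.
  let ι : X.index := Classical.arbitrary _
  have hcont : Continuous fun g => k ι g ι := by
    rw [(isOpenEmbedding_elt (φ ι) (φ ι)).isInducing.continuous_iff]
    have : Continuous fun g => H (elt ι g ι) := F.continuous.comp (continuous_elt ι ι)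
    simpa only [hk, Function.comp_def] using this
  refine ⟨⟨⟨MonoidHom.mk' (fun g => k ι g ι) (hkmul ι ι ι), hcont⟩, fun α => k α 1 ι,
    ⟨φ, hφinj⟩⟩, CCZeroSimpleInv.Hom.ext (MulHom.ext fun x => ?_)⟩
  rcases x with _ | ⟨α, g, β⟩
  · exact hzero.symm
  · change elt (φ α) (k α 1 ι * k ι g ι * (k β 1 ι)⁻¹) (φ β) = H (elt α g β)
    have hinv : (k β 1 ι)⁻¹ = k ι 1 β :=
      inv_eq_of_mul_eq_one_right (by rw [← hkmul, mul_one, hkone])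
    rw [hk, hinv, ← hkmul, ← hkmul, one_mul, mul_one]

theorem brandtFunctor_full : brandtFunctor.{u}.Full where
  map_surjective F := CCGroupPair.exists_brandtMap_eq F

theorem compactBrandtFunctor_full : compactBrandtFunctor.{u}.Full :=
  haveI := brandtFunctor_full.{u}
  inferInstanceAs (ObjectProperty.lift _ (ObjectProperty.ι _ ⋙ brandtFunctor.{u}) _).Full

theorem mainTheorem11 :
    (brandtFunctor.{u}.Full ∧ brandtFunctor.{u}.EssSurj) ∧
      (compactBrandtFunctor.{u}.Full ∧ compactBrandtFunctor.{u}.EssSurj) :=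
  ⟨⟨brandtFunctor_full, brandtFunctor_essSurj⟩,
    ⟨compactBrandtFunctor_full, compactBrandtFunctor_essSurj⟩⟩
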